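/- Let $t>0$ and let $H(\tau)$, $0\le\tau\le t$, be a time-dependent Hamiltonian on a finite-dimensional Hilbert space $\mathcal H$ (each $H(\tau)$ is a Hermitian matrix). Assume that $H$ is continuous except at a finite number of points, that $H(\tau)\neq 0$ for every $\tau\in[0,t]$, and that $\|H\|_{\infty,1}:=\int_0^t\|H(\tau)\|_\infty\,\mathrm d\tau<\infty$, where $\|\cdot\|_\infty$ is the spectral norm. Let $\mathrm E(t,0)=\exp_{\mathcal T}\bigl(-i\int_0^t H(\tau)\,\mathrm d\tau\bigr)$ be the time-ordered exponential, that is, the solution of $\mathrm E(u,0)=I-i\int_0^u H(\tau)\mathrm E(\tau,0)\,\mathrm d\tau$ for $0\le u\le t$, equivalently the sum of the Dyson series, and let $\mathcal E(t,0)(\rho)=\mathrm E(t,0)\,\rho\,\mathrm E(t,0)^\dagger$ be the ideal channel. For $0\le s<u\le t$ let $\mathcal U(u,s)$ be the continuous qDRIFT channel on $[s,u]$, $$\mathcal U(u,s)(\rho)=\int_s^u p(\tau)\,e^{-iH(\tau)/p(\tau)}\,\rho\,e^{iH(\tau)/p(\tau)}\,\mathrm d\tau,\qquad p(\tau)=\frac{\|H(\tau)\|_\infty}{\int_s^u\|H(\sigma)\|_\infty\,\mathrm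 d\sigma}.$$ For a linear map $\Phi$ on the matrices on $\mathcal H$, let $\|\Phi\|_\diamond=\max\{\|(\Phi\otimes\mathbb 1_{\mathcal H})(B)\|_1:\|B\|_1\le 1\}$, the maximum over matrices $B$ on $\mathcal H\otimes\mathcal H$, with $\|A\|_1=\mathrm{Tr}\sqrt{A^\dagger A}$. Then for every positive integer $r$ there is a division $0=t_0<t_1<\cdots<t_r=t$ such that $$\int_{t_j}^{t_{j+1}}\|H(\tau)\|_\infty\,\mathrm d\tau=\frac{\|H\|_{\infty,1}}{r}\qquad(0\le j<r)$$ and $$\bigl\|\mathcal E(t,0)-\mathcal U(t_r,t_{r-1})\circ\cdots\circ\mathcal U(t_2,t_1)\circ\mathcal U(t_1,t_0)\bigr\|_\diamond\le 4\,\frac{\|H\|_{\infty,1}^2}{r}.$$ Consequently, for this division and every $\epsilon>0$, if $r\ge 4\bigl\lceil\|H\|_{\infty,1}^2/\epsilon\bigr\rceil$, then this distance is at most $\epsilon$. -/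

import Mathlib

open MeasureTheory Set
open scoped Matrix Kronecker Matrix.Norms.L2Operator MatrixOrder ComplexOrder

namespace QDrift

/-! Throughout, matrices over `ℂ` carry the spectral norm `‖A‖` (the operator norm induced by the
Euclidean norm). -/

section Norms

variable {n m : Type*} [Fintype n] [DecidableEq n] [Fintype m] [DecidableEq m]

/-- The trace norm `‖A‖₁ = Tr √(A† A)`. -/
noncomputable def traceNorm (A : Matrix n n ℂ) : ℝ := (CFC.sqrt (Aᴴ * A)).trace.re

/-- `Φ ⊗ 𝟙`, for a linear map `Φ` on the matrices over `n`, acting on the matrices over `n × m`: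
`Φ` is applied to each of the blocks `(B (·, a) (·, b))`. -/
def ampliation (m : Type*) (Φ : Module.End ℂ (Matrix n n ℂ)) :
    Module.End ℂ (Matrix (n × m) (n × m) ℂ) where
  toFun B := Matrix.of fun x y => Φ (Matrix.of fun i j => B (i, x.2) (j, y.2)) x.1 y.1
  map_add' B C := by
    ext x y
    exact congrFun (congrFun (Φ.map_add (Matrix.of fun i j => B (i, x.2) (j, y.2))
      (Matrix.of fun i j => C (i, x.2) (j, y.2))) x.1) y.1
  map_smul' c B := by
    ext x y
    exact congrFun (congrFun (Φ.map_smul c (Matrix.of fun i j => B (i, x.2) (j, y.2))) x.1) y.1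

theorem ampliation_kronecker {n m : Type*} (Φ : Module.End ℂ (Matrix n n ℂ)) (A : Matrix n n ℂ)
    (C : Matrix m m ℂ) : ampliation m Φ (A ⊗ₖ C) = Φ A ⊗ₖ C := by
  ext x y
  have h : (Matrix.of fun i j => (A ⊗ₖ C) (i, x.2) (j, y.2)) = C x.2 y.2 • A := by
    ext i j; simp [mul_comm]
  simp only [ampliation, LinearMap.coe_mk, AddHom.coe_mk, Matrix.of_apply, h, map_smul]
  simp [mul_comm]

/-- The diamond norm `‖Φ‖_⋄ = max {‖(Φ ⊗ 𝟙)(B)‖₁ : ‖B‖₁ ≤ 1}`, where the ancilla has the same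
dimension as the system. (The set is the continuous image of a compact set, so that it is bounded
and the supremum is the maximum.) -/
noncomputable def diamondNorm (Φ : Module.End ℂ (Matrix n n ℂ)) : ℝ :=
  sSup ((fun B : Matrix (n × n) (n × n) ℂ => traceNorm (ampliation n Φ B)) ''
    {B | traceNorm B ≤ 1})

end Norms

section Evolution

variable {n : Type*} [Fintype n] [DecidableEq n]

/-- `∫_s^u ‖H(τ)‖ dτ`; the norm `‖H‖_{∞,1}` of `H` on `[0, t]` is `l1Norm H 0 t`. -/
noncomputable def l1Norm (H : ℝ → Matrix n n ℂ) (s u : ℝ) : ℝ := ∫ τ in s..u, ‖H τ‖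

/-- The `k`-th term of the Dyson series of `H` from time `s` to time `u`: the iterated integral
`(-i)^k ∫_s^u dτ₁ ∫_s^τ₁ dτ₂ ⋯ H(τ₁) H(τ₂) ⋯ H(τ_k)`. -/
noncomputable def dysonTerm (H : ℝ → Matrix n n ℂ) (s : ℝ) : ℕ → ℝ → Matrix n n ℂ
  | 0, _ => 1
  | k + 1, u => ∫ τ in s..u, (-Complex.I) • (H τ * dysonTerm H s k τ)

/-- The evolution operator `E(u, s)`, that is, the time-ordered exponential
`exp_T (-i ∫_s^u H(τ) dτ)`, as the sum of the Dyson series. It solves the Schrödinger equation,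
see `timeOrderedExp_integral_eq`. -/
noncomputable def timeOrderedExp (H : ℝ → Matrix n n ℂ) (s u : ℝ) : Matrix n n ℂ :=
  ∑' k, dysonTerm H s k u

/-- The ideal channel `ρ ↦ E(u, s) ρ E(u, s)†`. -/
noncomputable def idealChannel (H : ℝ → Matrix n n ℂ) (s u : ℝ) :
    Module.End ℂ (Matrix n n ℂ) where
  toFun ρ := timeOrderedExp H s u * ρ * (timeOrderedExp H s u)ᴴ
  map_add' ρ σ := by rw [mul_add, add_mul]
  map_smul' c ρ := by simp

/-- The sampling density `p(τ) = ‖H(τ)‖ / ∫_s^u ‖H‖` on the time interval `[s, u]`. -/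
noncomputable def density (H : ℝ → Matrix n n ℂ) (s u τ : ℝ) : ℝ := ‖H τ‖ / l1Norm H s u

/-- The sampled evolution `exp (-i H(τ) / p(τ))`. -/
noncomputable def sampledUnitary (H : ℝ → Matrix n n ℂ) (s u τ : ℝ) : Matrix n n ℂ :=
  NormedSpace.exp ((-Complex.I / (density H s u τ : ℂ)) • H τ)

/-- The inverse sampled evolution `exp (i H(τ) / p(τ))`. -/
noncomputable def sampledUnitaryInv (H : ℝ → Matrix n n ℂ) (s u τ : ℝ) : Matrix n n ℂ :=
  NormedSpace.exp ((Complex.I / (density H s u τ : ℂ)) • H τ)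

/-- The continuous qDRIFT channel
`ρ ↦ ∫_s^u p(τ) exp (-i H(τ) / p(τ)) ρ exp (i H(τ) / p(τ)) dτ`, written as an integral of linear
maps of `ρ`; the formula for each `ρ` is `qdriftChannel_apply`. -/
noncomputable def qdriftChannel (H : ℝ → Matrix n n ℂ) (s u : ℝ) :
    Module.End ℂ (Matrix n n ℂ) :=
  (∫ τ in s..u, density H s u τ •
    ContinuousLinearMap.mulLeftRight ℂ (Matrix n n ℂ)
      (sampledUnitary H s u τ) (sampledUnitaryInv H s u τ) :
    Matrix n n ℂ →L[ℂ] Matrix n n ℂ).toLinearMap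

/-- The time-ordered composition `U(t_r, t_{r-1}) ∘ ⋯ ∘ U(t_2, t_1) ∘ U(t_1, t_0)` of the
continuous qDRIFT channels of the first `r` segments. -/
noncomputable def qdriftProduct (H : ℝ → Matrix n n ℂ) (T : ℕ → ℝ) :
    ℕ → Module.End ℂ (Matrix n n ℂ)
  | 0 => LinearMap.id
  | r + 1 => (qdriftChannel H (T r) (T (r + 1))).comp (qdriftProduct H T r)

/-! ### The definitions are the intended ones -/

theorem aestronglyMeasurable_of_piecewise {H : ℝ → Matrix n n ℂ} {s u : ℝ} {S : Set ℝ}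
    (hS : S.Finite) (hcont : ContinuousOn H (Icc s u \ S)) :
    AEStronglyMeasurable H (volume.restrict (Icc s u)) := by
  have h1 := hcont.aestronglyMeasurable (μ := volume)
    (measurableSet_Icc.diff hS.measurableSet)
  have h2 : (volume : Measure ℝ).restrict (Icc s u \ S) = volume.restrict (Icc s u) :=
    Measure.restrict_congr_set (sdiff_null_ae_eq_self (hS.measure_zero _))
  rwa [h2] at h1

theorem qdriftChannel_apply {H : ℝ → Matrix n n ℂ} {s u : ℝ} (hsu : s ≤ u) {S : Set ℝ}
    (hS : S.Finite) (hherm : ∀ τ ∈ Icc s u, (H τ).IsHermitian)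
    (hcont : ContinuousOn H (Icc s u \ S)) (hint : IntegrableOn (fun τ => ‖H τ‖) (Icc s u))
    (ρ : Matrix n n ℂ) :
    qdriftChannel H s u ρ = ∫ τ in s..u, density H s u τ •
      (NormedSpace.exp ((-Complex.I / (density H s u τ : ℂ)) • H τ) * ρ *
        NormedSpace.exp ((Complex.I / (density H s u τ : ℂ)) • H τ)) := by
  have : CompleteSpace (Matrix n n ℂ) := FiniteDimensional.complete ℂ _
  let _ : NormedAlgebra ℚ (Matrix n n ℂ) := .restrictScalars ℚ ℂ _
  have hm := aestronglyMeasurable_of_piecewise hS hcont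
  have hd : AEStronglyMeasurable (density H s u) (volume.restrict (Icc s u)) := by
    simpa only [density, div_eq_mul_inv] using! hm.norm.mul_const (l1Norm H s u)⁻¹
  have hdi : IntegrableOn (density H s u) (Icc s u) := hint.div_const _
  have hexp : ∀ c : ℂ, AEStronglyMeasurable
      (fun τ => NormedSpace.exp ((c / (density H s u τ : ℂ)) • H τ))
      (volume.restrict (Icc s u)) := fun c =>
    (NormedSpace.exp_continuous (𝔸 := Matrix n n ℂ)).comp_aestronglyMeasurable
      (AEStronglyMeasurable.smul ((Complex.measurable_ofReal.comp_aemeasurable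
        hd.aemeasurable).const_div c).aestronglyMeasurable hm)
  have hbound : ∀ c : ℂ, star c = -c → ∀ τ ∈ Icc s u,
      ‖NormedSpace.exp ((c / (density H s u τ : ℂ)) • H τ)‖ ≤ 1 := fun c hc τ hτ => by
    cases subsingleton_or_nontrivial (Matrix n n ℂ)
    · rw [Subsingleton.elim (NormedSpace.exp _) (0 : Matrix n n ℂ), norm_zero]
      exact zero_le_one
    · refine (CStarRing.norm_of_mem_unitary
        (NormedSpace.exp_mem_unitary_of_mem_skewAdjoint ?_)).le
      have h1 : star (H τ) = H τ := hherm τ hτ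
      have h2 : star ((density H s u τ : ℝ) : ℂ) = (density H s u τ : ℂ) := Complex.conj_ofReal _
      rw [skewAdjoint.mem_iff, star_smul, h1, star_div₀, hc, h2, neg_div, neg_smul]
  have hInt : IntervalIntegrable (fun τ => density H s u τ •
      ContinuousLinearMap.mulLeftRight ℂ (Matrix n n ℂ)
        (sampledUnitary H s u τ) (sampledUnitaryInv H s u τ)) volume s u := by
    rw [intervalIntegrable_iff_integrableOn_Icc_of_le hsu]
    have hL := ContinuousLinearMap.aestronglyMeasurable_comp₂
      (ContinuousLinearMap.mulLeftRight ℂ (Matrix n n ℂ)) (hexp (-Complex.I)) (hexp Complex.I)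
    refine Integrable.mono' hdi.norm (hd.smul hL) ?_
    filter_upwards [ae_restrict_mem measurableSet_Icc] with τ hτ
    rw [norm_smul]
    refine mul_le_of_le_one_right (norm_nonneg _) ?_
    refine (ContinuousLinearMap.opNorm_mulLeftRight_apply_apply_le ℂ (Matrix n n ℂ) _ _).trans ?_
    exact mul_le_one₀ (hbound _ (by simp) τ hτ) (norm_nonneg _) (hbound _ (by simp) τ hτ)
  have := ContinuousLinearMap.intervalIntegral_apply hInt ρ
  simpa [qdriftChannel, sampledUnitary, sampledUnitaryInv] using! this

theorem dysonTerm_bound {H : ℝ → Matrix n n ℂ} {s u : ℝ} (hsu : s ≤ u) {S : Set ℝ}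
    (hS : S.Finite) (hcont : ContinuousOn H (Icc s u \ S))
    (hint : IntegrableOn (fun τ => ‖H τ‖) (Icc s u)) (k : ℕ) :
    ContinuousOn (dysonTerm H s k) (Icc s u) ∧
      ∀ v ∈ Icc s u, ‖dysonTerm H s k v‖ ≤ l1Norm H s v ^ k / k.factorial := by
  have : CompleteSpace (Matrix n n ℂ) := FiniteDimensional.complete ℂ _
  have hm := aestronglyMeasurable_of_piecewise hS hcont
  have hHi : IntegrableOn H (Icc s u) := (integrable_norm_iff hm).1 hint
  induction k with
  | zero =>
    refine ⟨continuousOn_const, fun v _ => ?_⟩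
    cases isEmpty_or_nonempty n
    · rw [Subsingleton.elim (dysonTerm H s 0 v) 0]; simp
    · simp [dysonTerm]
  | succ k ih =>
    obtain ⟨ihc, ihb⟩ := ih
    have hi : IntegrableOn (fun τ => (-Complex.I) • (H τ * dysonTerm H s k τ)) (Icc s u) :=
      by
      simpa only [Pi.smul_def] using!
        Integrable.smul (-Complex.I) (hHi.mul_continuousOn ihc isCompact_Icc)
    have hAc : ContinuousOn (l1Norm H s) (Icc s u) := by
      have := intervalIntegral.continuousOn_primitive_interval (a := s) (b := u) (μ := volume)
        (f := fun τ => ‖H τ‖) (by rwa [uIcc_of_le hsu])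
      rwa [uIcc_of_le hsu] at this
    refine ⟨?_, fun v hv => ?_⟩
    · have := intervalIntegral.continuousOn_primitive_interval (a := s) (b := u) (μ := volume)
        (f := fun τ => (-Complex.I) • (H τ * dysonTerm H s k τ)) (by rwa [uIcc_of_le hsu])
      rwa [uIcc_of_le hsu] at this
    · have hsub : Icc s v ⊆ Icc s u := Icc_subset_Icc_right hv.2
      have hmaj : IntervalIntegrable
          (fun τ => ‖H τ‖ * (l1Norm H s τ ^ k / k.factorial)) volume s v := by
        rw [intervalIntegrable_iff_integrableOn_Icc_of_le hv.1]
        exact (hint.mono_set hsub).mul_continuousOn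
          (((hAc.mono hsub).pow k).div_const _) isCompact_Icc
      have hFTC : ∫ τ in s..v, ‖H τ‖ * (l1Norm H s τ ^ k / k.factorial) =
          l1Norm H s v ^ (k + 1) / (k + 1).factorial := by
        have := integral_eq_of_hasDerivAt_off_countable_of_le
          (fun τ => l1Norm H s τ ^ (k + 1) / (k + 1).factorial)
          (fun τ => ‖H τ‖ * (l1Norm H s τ ^ k / k.factorial)) hv.1 hS.countable
          (((hAc.mono hsub).pow _).div_const _) (fun x hx => ?_) hmaj
        · rw [this]; simp [l1Norm]
        · have hnhds : Icc s u \ S ∈ nhds x :=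
            Filter.mem_of_superset ((isOpen_Ioo.sdiff hS.isClosed).mem_nhds hx)
              (sdiff_subset_sdiff_left (Ioo_subset_Icc_self.trans hsub))
          have hca : ContinuousOn (fun τ => ‖H τ‖) (Icc s u \ S) := hcont.norm
          have hd : HasDerivAt (l1Norm H s) ‖H x‖ x :=
            intervalIntegral.integral_hasDerivAt_right
              ((intervalIntegrable_iff_integrableOn_Icc_of_le hx.1.1.le).2
                (hint.mono_set ((Icc_subset_Icc_right hx.1.2.le).trans hsub)))
              ⟨_, hnhds, hca.aestronglyMeasurable (measurableSet_Icc.diff hS.measurableSet)⟩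
              (hca.continuousAt hnhds)
          refine ((hd.pow (k + 1)).div_const ((k + 1).factorial : ℝ)).congr_deriv ?_
          have : ((k : ℝ) + 1) ≠ 0 := by positivity
          have : (k.factorial : ℝ) ≠ 0 := by positivity
          rw [Nat.factorial_succ]
          push_cast
          field_simp
      rw [dysonTerm, ← hFTC]
      refine intervalIntegral.norm_integral_le_of_norm_le hv.1
        (Filter.Eventually.of_forall fun τ hτ => ?_) hmaj
      rw [norm_smul, norm_neg, Complex.norm_I, one_mul]
      exact (norm_mul_le _ _).trans (mul_le_mul_of_nonneg_left
        (ihb τ (hsub (Ioc_subset_Icc_self hτ))) (norm_nonneg _))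

theorem timeOrderedExp_integral_eq {H : ℝ → Matrix n n ℂ} {s u : ℝ} (hsu : s ≤ u) {S : Set ℝ}
    (hS : S.Finite) (hcont : ContinuousOn H (Icc s u \ S))
    (hint : IntegrableOn (fun τ => ‖H τ‖) (Icc s u)) :
    ContinuousOn (timeOrderedExp H s) (Icc s u) ∧ ∀ v ∈ Icc s u,
      timeOrderedExp H s v = 1 - Complex.I • ∫ τ in s..v, H τ * timeOrderedExp H s τ := by
  have : CompleteSpace (Matrix n n ℂ) := FiniteDimensional.complete ℂ _
  have hm := aestronglyMeasurable_of_piecewise hS hcont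
  have hHi : IntegrableOn H (Icc s u) := (integrable_norm_iff hm).1 hint
  set M : ℝ := l1Norm H s u
  have hmono : ∀ v ∈ Icc s u, l1Norm H s v ≤ M := fun v hv =>
    intervalIntegral.integral_mono_interval le_rfl hv.1 hv.2
      (Filter.Eventually.of_forall fun τ => norm_nonneg _)
      ((intervalIntegrable_iff_integrableOn_Icc_of_le hsu).2 hint)
  have hb : ∀ k, ∀ v ∈ Icc s u, ‖dysonTerm H s k v‖ ≤ M ^ k / k.factorial := fun k v hv => by
    refine ((dysonTerm_bound hsu hS hcont hint k).2 v hv).trans ?_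
    have h0 : 0 ≤ l1Norm H s v :=
      intervalIntegral.integral_nonneg hv.1 fun τ _ => norm_nonneg _
    gcongr
    exact hmono v hv
  have hsum : Summable fun k : ℕ => M ^ k / (k.factorial : ℝ) := Real.summable_pow_div_factorial M
  have hD : ∀ v ∈ Icc s u, Summable fun k => dysonTerm H s k v := fun v hv =>
    Summable.of_norm_bounded hsum fun k => hb k v hv
  refine ⟨continuousOn_tsum (fun k => (dysonTerm_bound hsu hS hcont hint k).1) hsum hb,
    fun v hv => ?_⟩
  have hsub : Icc s v ⊆ Icc s u := Icc_subset_Icc_right hv.2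
  have hI : Set.uIoc s v ⊆ Icc s u := by
    rw [uIoc_of_le hv.1]; exact Ioc_subset_Icc_self.trans hsub
  have hkey : HasSum (fun k => dysonTerm H s (k + 1) v)
      (∫ τ in s..v, (-Complex.I) • (H τ * timeOrderedExp H s τ)) := by
    refine intervalIntegral.hasSum_integral_of_dominated_convergence
      (fun k τ => ‖H τ‖ * (M ^ k / k.factorial)) (fun k => ?_) (fun k => ?_) ?_ ?_ ?_
    · exact ((hHi.mul_continuousOn (dysonTerm_bound hsu hS hcont hint k).1
        isCompact_Icc).smul (-Complex.I)).aestronglyMeasurable.mono_measure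
          (Measure.restrict_mono hI le_rfl)
    · refine Filter.Eventually.of_forall fun τ hτ => ?_
      rw [norm_smul, norm_neg, Complex.norm_I, one_mul]
      exact (norm_mul_le _ _).trans (mul_le_mul_of_nonneg_left (hb k τ (hI hτ)) (norm_nonneg _))
    · exact Filter.Eventually.of_forall fun τ _ => hsum.mul_left _
    · simp_rw [tsum_mul_left]
      refine IntervalIntegrable.mul_const ?_ _
      exact (intervalIntegrable_iff_integrableOn_Icc_of_le hv.1).2 (hint.mono_set hsub)
    · exact Filter.Eventually.of_forall fun τ hτ =>
        (((hD τ (hI hτ)).hasSum).mul_left (H τ)).const_smul _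
  rw [timeOrderedExp, (hD v hv).tsum_eq_zero_add, hkey.tsum_eq, intervalIntegral.integral_smul,
    neg_smul, ← sub_eq_add_neg]
  rfl

end Evolution

end QDrift

namespace QDrift

/-! ### Duality of trace norm and spectral norm. -/

section TraceDuality

variable {n : Type*} [Fintype n] [DecidableEq n]

/-! The estimate is made in the Heisenberg picture. The trace norm of `A` is the supremum of `|Tr (X
A)|` over `‖X‖ ≤ 1`, so the diamond distance is controlled by testing the ampliated channels against
`X` and moving them onto `X`. There the ideal evolution is `X ↦ V† X V` with `V = E ⊗ 1`, and a
qDRIFT segment is the average of `X ↦ W† X W` over the sampled unitaries `W`.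

On a segment of weight `ℓ = ∫ ‖H‖` both maps have the same first-order part `X + ∫ i[H, X]`:
sampling `H/p` with density `p` leaves the integral of `H` unchanged. Each differs from it by at
most `2 ℓ² ‖X‖`. For the evolution this is Duhamel's formula used twice
(`norm_conj_sub_firstOrder_le`). For a sampled unitary it is the same bound for the constant
Hamiltonian `H/p` on `[0, 1]`, whose norm is exactly `ℓ` at every sampled time. So a segment costs
`4 ℓ²` (`norm_conj_sub_conj_dualChannel_le`).

All the dual maps are contractions, so the segment errors add up (`norm_trace_ampliation_sub_le`).
With `r` segments of weight `L/r`, chosen by the intermediate value theorem, the total is `r · 4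
(L/r)² = 4 L²/r`. -/

theorem norm_star_dotProduct_mulVec_le (Z : Matrix n n ℂ) (x : n → ℂ) :
    ‖star x ⬝ᵥ (Z *ᵥ x)‖ ≤ ‖Z‖ * ∑ k, ‖x k‖ ^ 2 := by
  have h1 : star x ⬝ᵥ (Z *ᵥ x) =
      inner ℂ (WithLp.toLp 2 x) (WithLp.toLp 2 (Z *ᵥ x) : EuclideanSpace ℂ n) := by
    rw [EuclideanSpace.inner_eq_star_dotProduct, dotProduct_comm]
  have h2 : ∑ k, ‖x k‖ ^ 2 = ‖(WithLp.toLp 2 x : EuclideanSpace ℂ n)‖ ^ 2 := by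
    rw [EuclideanSpace.norm_sq_eq]
  rw [h1, h2]
  refine (norm_inner_le_norm _ _).trans ?_
  have := Matrix.l2_opNorm_mulVec Z (WithLp.toLp 2 x)
  calc _ ≤ ‖(WithLp.toLp 2 x : EuclideanSpace ℂ n)‖ *
        (‖Z‖ * ‖(WithLp.toLp 2 x : EuclideanSpace ℂ n)‖) := by gcongr; exact this
    _ = _ := by ring

/-- Factor `P = R† R`: by cyclicity the trace is a sum of quadratic forms of `Z` at the conjugated
rows of `R`, whose squared lengths add up to `Tr P`. -/
theorem norm_trace_mul_le_of_posSemidef (Z : Matrix n n ℂ) {P : Matrix n n ℂ}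
    (hP : P.PosSemidef) : ‖(Z * P).trace‖ ≤ ‖Z‖ * P.trace.re := by
  obtain ⟨R, rfl⟩ := CStarAlgebra.nonneg_iff_eq_star_mul_self.1 hP.nonneg
  have h1 : (Z * (Rᴴ * R)).trace = ∑ i, star (star (R i)) ⬝ᵥ (Z *ᵥ star (R i)) := by
    rw [← mul_assoc, Matrix.trace_mul_comm, Matrix.trace]
    refine Finset.sum_congr rfl fun i _ => ?_
    rw [star_star]
    rfl
  have h2 : (Rᴴ * R).trace.re = ∑ i, ∑ k, ‖star (R i) k‖ ^ 2 := by
    rw [Matrix.trace_mul_comm, Matrix.trace, Complex.re_sum]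
    refine Finset.sum_congr rfl fun i _ => ?_
    simp [Matrix.mul_apply, Matrix.diag_apply, Complex.mul_conj, Complex.normSq_eq_norm_sq,
      -Complex.ofReal_pow]
  rw [Matrix.star_eq_conjTranspose, h1, h2, Finset.mul_sum]
  exact (norm_sum_le _ _).trans (Finset.sum_le_sum fun i _ => norm_star_dotProduct_mulVec_le Z _)

/-- A polar decomposition of `A` up to `ε`. -/
theorem exists_approx_polar (A : Matrix n n ℂ) {ε : ℝ} (hε : 0 < ε) :
    ∃ U : Matrix n n ℂ, ‖U‖ ≤ 1 ∧ A = U * (CFC.sqrt (Aᴴ * A) + (ε : ℂ) • 1) ∧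
      traceNorm A - ε * Fintype.card n ≤ (Uᴴ * A).trace.re := by
  set P := CFC.sqrt (Aᴴ * A) with hPdef
  have hAA : 0 ≤ Aᴴ * A := (Matrix.posSemidef_conjTranspose_mul_self A).nonneg
  have hP0 : 0 ≤ P := CFC.sqrt_nonneg _
  have hPP : P * P = Aᴴ * A := CFC.sqrt_mul_sqrt_self _ hAA
  have hPs : P.PosSemidef := Matrix.nonneg_iff_posSemidef.1 hP0
  have hε' : (0 : ℂ) < ε := by exact_mod_cast hε
  have hQpd : (P + (ε : ℂ) • 1).PosDef :=
    Matrix.PosDef.posSemidef_add hPs (Matrix.PosDef.one.smul hε')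
  set Q := P + (ε : ℂ) • (1 : Matrix n n ℂ) with hQdef
  have hdet : IsUnit Q.det := (Matrix.isUnit_iff_isUnit_det _).1 hQpd.isUnit
  have hRpd : Q⁻¹.PosDef := hQpd.inv
  set R := Q⁻¹ with hRdef
  have hRQ : R * Q = 1 := Matrix.nonsing_inv_mul _ hdet
  have hQR : Q * R = 1 := Matrix.mul_nonsing_inv _ hdet
  have hRh : Rᴴ = R := hRpd.isHermitian
  -- Division of `P²` by `Q = P + ε`, which yields `Q⁻¹ P² = P - ε + ε² Q⁻¹`, and hence the lower
  -- bound on `Tr (U† A)`.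
  have hP2 : P * P = Q * (P - (ε : ℂ) • 1) + ((ε : ℂ) ^ 2) • 1 := by
    rw [hQdef]; simp [add_mul, mul_sub, smul_smul]; module
  have hUA : (A * R)ᴴ * A = R * (P * P) := by
    rw [Matrix.conjTranspose_mul, hRh, mul_assoc, hPP]
  -- `U = A (P + ε)⁻¹`; the shift by `ε` replaces the inverse of `P`, which may be singular.
  -- Contractivity comes from `1 - U† U = R (2ε P + ε²) R ≥ 0`.
  refine ⟨A * R, ?_, by rw [mul_assoc, hRQ, mul_one], ?_⟩
  · have hle : (A * R)ᴴ * (A * R) ≤ 1 := by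
      have h1 : (1 : Matrix n n ℂ) - (A * R)ᴴ * (A * R) =
          Rᴴ * ((2 * ε : ℂ) • P + ((ε : ℂ) ^ 2) • 1) * R := by
        have h3 : (2 * ε : ℂ) • P + ((ε : ℂ) ^ 2) • (1 : Matrix n n ℂ) = Q * Q - P * P := by
          rw [hQdef]; simp [add_mul, mul_add, smul_smul]; module
        rw [h3, ← mul_assoc, hUA, hRh, mul_sub, sub_mul, ← mul_assoc R Q Q, hRQ, one_mul, hQR]
      rw [← sub_nonneg, h1]
      refine Matrix.PosSemidef.nonneg (Matrix.PosSemidef.conjTranspose_mul_mul_same ?_ R)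
      refine (hPs.smul ?_).add (Matrix.PosSemidef.one.smul ?_)
      · exact_mod_cast (by positivity : 0 ≤ 2 * ε)
      · exact_mod_cast (by positivity : 0 ≤ ε ^ 2)
    have h4 : ‖(A * R)ᴴ * (A * R)‖ ≤ 1 :=
      (CStarAlgebra.norm_le_one_iff_of_nonneg _
        (Matrix.posSemidef_conjTranspose_mul_self _).nonneg).2 hle
    rw [Matrix.l2_opNorm_conjTranspose_mul_self] at h4
    nlinarith [norm_nonneg (A * R)]
  · have h5 : R * (P * P) = P - (ε : ℂ) • 1 + ((ε : ℂ) ^ 2) • R := by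
      rw [hP2, mul_add, ← mul_assoc, hRQ, one_mul, mul_smul_comm, mul_one]
    have h6 : 0 ≤ R.trace.re := (Complex.nonneg_iff.1 hRpd.posSemidef.trace_nonneg).1
    rw [hUA, h5, traceNorm, ← hPdef]
    simp only [Matrix.trace_add, Matrix.trace_sub, Matrix.trace_smul, Matrix.trace_one,
      Complex.add_re, Complex.sub_re, smul_eq_mul, ← Complex.ofReal_pow, Complex.re_ofReal_mul,
      Complex.natCast_re]
    nlinarith [mul_nonneg (sq_nonneg ε) h6]

theorem traceNorm_nonneg (A : Matrix n n ℂ) : 0 ≤ traceNorm A :=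
  (Complex.nonneg_iff.1
    (Matrix.nonneg_iff_posSemidef.1 (CFC.sqrt_nonneg (Aᴴ * A))).trace_nonneg).1

/-- Hölder's inequality: absorb the approximate polar factor into `Y`, apply the positive
semidefinite case, and let `ε → 0`. -/
theorem norm_trace_mul_le (Y A : Matrix n n ℂ) : ‖(Y * A).trace‖ ≤ ‖Y‖ * traceNorm A := by
  have key : ∀ ε : ℝ, 0 < ε → ‖(Y * A).trace‖ ≤ ‖Y‖ * (traceNorm A + ε * Fintype.card n) := by
    intro ε hε
    obtain ⟨U, hU, hA, -⟩ := exists_approx_polar A hε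
    have hps : (CFC.sqrt (Aᴴ * A) + (ε : ℂ) • 1 : Matrix n n ℂ).PosSemidef :=
      (Matrix.nonneg_iff_posSemidef.1 (CFC.sqrt_nonneg _)).add
        (Matrix.PosSemidef.one.smul (by exact_mod_cast hε.le))
    have h := norm_trace_mul_le_of_posSemidef (Y * U) hps
    rw [mul_assoc, ← hA] at h
    have htr : (CFC.sqrt (Aᴴ * A) + (ε : ℂ) • 1 : Matrix n n ℂ).trace.re =
        traceNorm A + ε * Fintype.card n := by
      simp [traceNorm, Matrix.trace_add, Matrix.trace_smul]
    rw [htr] at h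
    refine h.trans (mul_le_mul_of_nonneg_right ?_
      (add_nonneg (traceNorm_nonneg A) (by positivity)))
    exact (norm_mul_le _ _).trans (mul_le_of_le_one_right (norm_nonneg _) hU)
  have hlim : Filter.Tendsto (fun ε : ℝ => ‖Y‖ * (traceNorm A + ε * Fintype.card n))
      (nhdsWithin 0 (Ioi 0)) (nhds (‖Y‖ * (traceNorm A + 0 * Fintype.card n))) :=
    ((by fun_prop : Continuous fun ε : ℝ =>
      ‖Y‖ * (traceNorm A + ε * Fintype.card n)).tendsto 0).mono_left nhdsWithin_le_nhds
  rw [zero_mul, add_zero] at hlim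
  exact ge_of_tendsto hlim (eventually_nhdsWithin_of_forall fun ε hε => key ε hε)

/-- The test matrix `X = U†` from the approximate polar decomposition nearly attains the trace norm.
-/
theorem traceNorm_le_of_forall_norm_trace_le (A : Matrix n n ℂ) {c : ℝ}
    (h : ∀ X : Matrix n n ℂ, ‖X‖ ≤ 1 → ‖(X * A).trace‖ ≤ c) : traceNorm A ≤ c := by
  have key : ∀ ε : ℝ, 0 < ε → traceNorm A - ε * Fintype.card n ≤ c := by
    intro ε hε
    obtain ⟨U, hU, -, hA⟩ := exists_approx_polar A hε
    exact hA.trans ((Complex.re_le_norm _).trans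
      (h _ (by rwa [Matrix.l2_opNorm_conjTranspose])))
  have hlim : Filter.Tendsto (fun ε : ℝ => traceNorm A - ε * Fintype.card n)
      (nhdsWithin 0 (Ioi 0)) (nhds (traceNorm A - 0 * Fintype.card n)) :=
    ((by fun_prop : Continuous fun ε : ℝ =>
      traceNorm A - ε * Fintype.card n).tendsto 0).mono_left nhdsWithin_le_nhds
  rw [zero_mul, sub_zero] at hlim
  exact le_of_tendsto hlim (eventually_nhdsWithin_of_forall fun ε hε => key ε hε)

end TraceDuality

/-! ### Ampliation by an ancilla. -/

section Ampliation

variable {n : Type*} [Fintype n] [DecidableEq n]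

/-- The `*`-homomorphism `A ↦ A ⊗ 1`. -/
def kroneckerOne (m : Type*) [Fintype m] [DecidableEq m] :
    Matrix n n ℂ →⋆ₐ[ℂ] Matrix (n × m) (n × m) ℂ where
  toFun A := A ⊗ₖ 1
  map_one' := by simp
  map_mul' A B := by rw [← Matrix.mul_kronecker_mul, one_mul]
  map_zero' := by simp
  map_add' A B := by rw [Matrix.add_kronecker]
  commutes' c := by simp [Algebra.algebraMap_eq_smul_one, Matrix.smul_kronecker]
  map_star' A := by simp [Matrix.star_eq_conjTranspose, Matrix.conjTranspose_kronecker]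

variable {m : Type*} [Fintype m] [DecidableEq m]

theorem norm_kroneckerOne_le (A : Matrix n n ℂ) : ‖kroneckerOne m A‖ ≤ ‖A‖ :=
  NonUnitalStarAlgHom.norm_apply_le (kroneckerOne m : Matrix n n ℂ →⋆ₐ[ℂ] _) A

theorem ampliation_apply_of_eq_mul_mul {Φ : Module.End ℂ (Matrix n n ℂ)} {u v : Matrix n n ℂ}
    (h : ∀ ρ, Φ ρ = u * ρ * v) (B : Matrix (n × m) (n × m) ℂ) :
    ampliation m Φ B = kroneckerOne m u * B * kroneckerOne m v := by
  ext ⟨i, a⟩ ⟨j, b⟩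
  simp only [ampliation, LinearMap.coe_mk, AddHom.coe_mk, Matrix.of_apply, h]
  simp [kroneckerOne, Matrix.mul_apply, Matrix.kroneckerMap_apply, Fintype.sum_prod_type,
    Matrix.one_apply, Finset.sum_mul]

/-- `Φ ↦ Tr (X (Φ ⊗ 𝟙)(B))`, as a linear functional. -/
def ampliationPairing (X B : Matrix (n × m) (n × m) ℂ) :
    Module.End ℂ (Matrix n n ℂ) →ₗ[ℂ] ℂ where
  toFun Φ := (X * ampliation m Φ B).trace
  map_add' Φ Ψ := by
    rw [← Matrix.trace_add, ← mul_add]; rfl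
  map_smul' c Φ := by
    rw [RingHom.id_apply, ← Matrix.trace_smul, ← Matrix.mul_smul]; rfl

end Ampliation

/-! ### Heisenberg evolution and its first-order approximation. -/

section Heisenberg

variable {A : Type*} [CStarAlgebra A]

/-- The Heisenberg generator `X ↦ i [K, X]`. -/
noncomputable def heisenberg (K X : A) : A := Complex.I • (K * X - X * K)

theorem norm_heisenberg_le (K X : A) : ‖heisenberg K X‖ ≤ 2 * ‖K‖ * ‖X‖ := by
  rw [heisenberg, norm_smul, Complex.norm_I, one_mul]
  calc _ ≤ ‖K * X‖ + ‖X * K‖ := norm_sub_le _ _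
    _ ≤ ‖K‖ * ‖X‖ + ‖X‖ * ‖K‖ := add_le_add (norm_mul_le _ _) (norm_mul_le _ _)
    _ = _ := by ring

theorem norm_star_mul_mul_le {v : A} (hv : ‖v‖ ≤ 1) (X : A) : ‖star v * X * v‖ ≤ ‖X‖ := by
  have h1 : ‖star v * X‖ ≤ ‖X‖ :=
    (norm_mul_le _ _).trans (mul_le_of_le_one_left (norm_nonneg _) (by rwa [norm_star]))
  exact (norm_mul_le _ _).trans ((mul_le_of_le_one_right (norm_nonneg _) hv).trans h1)

/-- `V` solves the Schrödinger equation `V' = -i K V` on `[a, b]` off a finite set `S`, with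
integrable Hamiltonian `K`. -/
structure IsSchrodingerOn (K V : ℝ → A) (S : Set ℝ) (a b : ℝ) : Prop where
  finite : S.Finite
  continuousOn : ContinuousOn V (Icc a b)
  selfAdjoint : ∀ τ ∈ Icc a b, star (K τ) = K τ
  integrableOn : IntegrableOn K (Icc a b)
  hasDerivAt : ∀ τ ∈ Ioo a b \ S, HasDerivAt V (-Complex.I • (K τ * V τ)) τ

namespace IsSchrodingerOn

variable {K V : ℝ → A} {S : Set ℝ} {a b : ℝ}

theorem mono (h : IsSchrodingerOn K V S a b) {a' b' : ℝ} (ha : a ≤ a') (hb : b' ≤ b) :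
    IsSchrodingerOn K V S a' b' where
  finite := h.finite
  continuousOn := h.continuousOn.mono (Icc_subset_Icc ha hb)
  selfAdjoint τ hτ := h.selfAdjoint τ (Icc_subset_Icc ha hb hτ)
  integrableOn := h.integrableOn.mono_set (Icc_subset_Icc ha hb)
  hasDerivAt τ hτ := h.hasDerivAt τ ⟨Ioo_subset_Ioo ha hb hτ.1, hτ.2⟩

/-- Self-adjointness of `K` gives `(V†)' = i V† K`, so the two terms of the product rule combine
into a commutator. -/
theorem hasDerivAt_conj (h : IsSchrodingerOn K V S a b) (X : A) {τ : ℝ} (hτ : τ ∈ Ioo a b \ S) :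
    HasDerivAt (fun τ => star (V τ) * X * V τ)
      (star (V τ) * heisenberg (K τ) X * V τ) τ := by
  have hV := h.hasDerivAt τ hτ
  refine ((hV.star.mul_const X).mul hV).congr_deriv ?_
  have hs : star (-Complex.I • (K τ * V τ)) = Complex.I • (star (V τ) * K τ) := by
    rw [star_smul, star_mul, h.selfAdjoint τ (Ioo_subset_Icc_self hτ.1)]
    simp
  rw [hs, heisenberg]
  simp only [smul_mul_assoc, mul_smul_comm, mul_sub, sub_mul, neg_smul, smul_sub, mul_assoc,
    mul_neg, ← sub_eq_add_neg]

theorem integrableOn_heisenberg (h : IsSchrodingerOn K V S a b) (X : A) :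
    IntegrableOn (fun τ => heisenberg (K τ) X) (Icc a b) := by
  have h1 : IntegrableOn (fun τ => K τ * X) (Icc a b) :=
    h.integrableOn.mul_continuousOn continuousOn_const isCompact_Icc
  have h2 : IntegrableOn (fun τ => X * K τ) (Icc a b) :=
    h.integrableOn.continuousOn_mul continuousOn_const isCompact_Icc
  exact (h1.sub h2).smul Complex.I

theorem integrableOn_conj_heisenberg (h : IsSchrodingerOn K V S a b) (X : A) :
    IntegrableOn (fun τ => star (V τ) * heisenberg (K τ) X * V τ) (Icc a b) :=
  ((h.integrableOn_heisenberg X).continuousOn_mul h.continuousOn.star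
    isCompact_Icc).mul_continuousOn h.continuousOn isCompact_Icc

theorem integral_conj_heisenberg (h : IsSchrodingerOn K V S a b) (hab : a ≤ b) (X : A) :
    ∫ τ in a..b, star (V τ) * heisenberg (K τ) X * V τ =
      star (V b) * X * V b - star (V a) * X * V a :=
  integral_eq_of_hasDerivAt_off_countable_of_le (fun τ => star (V τ) * X * V τ) _ hab
    h.finite.countable ((h.continuousOn.star.mul continuousOn_const).mul h.continuousOn)
    (fun _ hτ => h.hasDerivAt_conj X hτ)
    ((intervalIntegrable_iff_integrableOn_Icc_of_le hab).2 (h.integrableOn_conj_heisenberg X))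

/-- The case `X = 1` of the integrated Heisenberg equation, where the commutator vanishes. -/
theorem star_mul_self (h : IsSchrodingerOn K V S a b) (h0 : star (V a) * V a = 1) {v : ℝ}
    (hv : v ∈ Icc a b) : star (V v) * V v = 1 := by
  have := (h.mono le_rfl hv.2).integral_conj_heisenberg hv.1 1
  exact sub_eq_zero.1 (by simpa [heisenberg, h0] using! this.symm)

theorem norm_le_one (h : IsSchrodingerOn K V S a b) (h0 : star (V a) * V a = 1) {v : ℝ}
    (hv : v ∈ Icc a b) : ‖V v‖ ≤ 1 := by
  have h1 : ‖(1 : A)‖ ≤ 1 := by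
    cases subsingleton_or_nontrivial A
    · rw [Subsingleton.elim (1 : A) 0, norm_zero]; exact zero_le_one
    · exact CStarRing.norm_one.le
  have h2 := CStarRing.norm_star_mul_self (x := V v)
  rw [h.star_mul_self h0 hv] at h2
  nlinarith [norm_nonneg (V v)]

variable {k : ℝ → ℝ}

theorem norm_conj_sub_conj_le (h : IsSchrodingerOn K V S a b) (hab : a ≤ b)
    (hV : ∀ τ ∈ Icc a b, ‖V τ‖ ≤ 1) (hk : IntegrableOn k (Icc a b))
    (hKk : ∀ τ ∈ Icc a b, ‖K τ‖ ≤ k τ) (X : A) :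
    ‖star (V b) * X * V b - star (V a) * X * V a‖ ≤ 2 * (∫ τ in a..b, k τ) * ‖X‖ := by
  rw [← h.integral_conj_heisenberg hab, mul_right_comm, ← intervalIntegral.integral_const_mul]
  refine intervalIntegral.norm_integral_le_of_norm_le hab
    (Filter.Eventually.of_forall fun τ hτ => ?_)
    (((intervalIntegrable_iff_integrableOn_Icc_of_le hab).2 hk).const_mul _)
  have hτ' := Ioc_subset_Icc_self hτ
  refine (norm_star_mul_mul_le (hV τ hτ') _).trans ((norm_heisenberg_le _ _).trans ?_)
  rw [mul_right_comm]
  exact mul_le_mul_of_nonneg_left (hKk τ hτ') (by positivity)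

end IsSchrodingerOn

/-- The integrand is the derivative of half the square of the primitive, off the finite set `S`. -/
theorem integral_mul_primitive {k : ℝ → ℝ} {S : Set ℝ} {a b : ℝ} (hab : a ≤ b) (hS : S.Finite)
    (hk : IntegrableOn k (Icc a b)) (hkc : ContinuousOn k (Icc a b \ S)) :
    IntegrableOn (fun τ => k τ * ∫ σ in a..τ, k σ) (Icc a b) ∧
      ∫ τ in a..b, k τ * ∫ σ in a..τ, k σ = (∫ τ in a..b, k τ) ^ 2 / 2 := by
  have hc : ContinuousOn (fun τ => ∫ σ in a..τ, k σ) (Icc a b) := by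
    have := intervalIntegral.continuousOn_primitive_interval (a := a) (b := b) (μ := volume)
      (f := k) (by rwa [uIcc_of_le hab])
    rwa [uIcc_of_le hab] at this
  have hi : IntegrableOn (fun τ => k τ * ∫ σ in a..τ, k σ) (Icc a b) :=
    hk.mul_continuousOn hc isCompact_Icc
  refine ⟨hi, ?_⟩
  have := integral_eq_of_hasDerivAt_off_countable_of_le
    (fun τ => (∫ σ in a..τ, k σ) ^ 2 / 2) (fun τ => k τ * ∫ σ in a..τ, k σ) hab hS.countable
    ((hc.pow 2).div_const 2) (fun x hx => ?_)
    ((intervalIntegrable_iff_integrableOn_Icc_of_le hab).2 hi)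
  · rw [this]; simp
  -- A finite set is closed, so continuity on the complement of `S` is continuity at `x`.
  · have hnhds : Icc a b \ S ∈ nhds x :=
      Filter.mem_of_superset ((isOpen_Ioo.sdiff hS.isClosed).mem_nhds hx)
        (sdiff_subset_sdiff_left Ioo_subset_Icc_self)
    have hd : HasDerivAt (fun τ => ∫ σ in a..τ, k σ) (k x) x :=
      intervalIntegral.integral_hasDerivAt_right
        ((intervalIntegrable_iff_integrableOn_Icc_of_le hx.1.1.le).2
          (hk.mono_set (Icc_subset_Icc_right hx.1.2.le)))
        ⟨_, hnhds, hkc.aestronglyMeasurable (measurableSet_Icc.diff hS.measurableSet)⟩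
        (hkc.continuousAt hnhds)
    refine ((hd.pow 2).div_const 2).congr_deriv ?_
    simp
    ring

/-- Freezing `V τ` at `V a` in the integrated Heisenberg equation costs `2 ∫_a^τ k` times `‖i[K τ,
X]‖ ≤ 2 k(τ) ‖X‖`; integrating `4 k(τ) ∫_a^τ k` gives the constant `2`. No condition `V a = 1` is
imposed, so the bound applies to an evolution started before `a`. -/
theorem IsSchrodingerOn.norm_conj_sub_firstOrder_le {K V : ℝ → A} {S : Set ℝ} {a b : ℝ}
    {k : ℝ → ℝ} (h : IsSchrodingerOn K V S a b) (hab : a ≤ b)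
    (hV : ∀ τ ∈ Icc a b, ‖V τ‖ ≤ 1) (hk : IntegrableOn k (Icc a b))
    (hkc : ContinuousOn k (Icc a b \ S)) (hKk : ∀ τ ∈ Icc a b, ‖K τ‖ ≤ k τ) (X : A) :
    ‖star (V b) * X * V b - star (V a) * (X + ∫ τ in a..b, heisenberg (K τ) X) * V a‖ ≤
      2 * (∫ τ in a..b, k τ) ^ 2 * ‖X‖ := by
  have hi1 : IntervalIntegrable (fun τ => heisenberg (K τ) X) volume a b :=
    (intervalIntegrable_iff_integrableOn_Icc_of_le hab).2 (h.integrableOn_heisenberg X)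
  have hi2 := (intervalIntegrable_iff_integrableOn_Icc_of_le hab).2
    (h.integrableOn_conj_heisenberg X)
  have e1 : star (V a) * (∫ τ in a..b, heisenberg (K τ) X) * V a =
      ∫ τ in a..b, star (V a) * heisenberg (K τ) X * V a := by
    have := ContinuousLinearMap.intervalIntegral_comp_comm
      (ContinuousLinearMap.mulLeftRight ℂ A (star (V a)) (V a)) hi1
    simpa using! this.symm
  have hi3 : IntervalIntegrable (fun τ => star (V a) * heisenberg (K τ) X * V a) volume a b := by
    have h1 : IntegrableOn (fun τ => star (V a) * heisenberg (K τ) X) (Icc a b) :=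
      (h.integrableOn_heisenberg X).continuousOn_mul continuousOn_const isCompact_Icc
    exact (intervalIntegrable_iff_integrableOn_Icc_of_le hab).2
      (h1.mul_continuousOn continuousOn_const isCompact_Icc)
  have e2 : star (V b) * X * V b -
      star (V a) * (X + ∫ τ in a..b, heisenberg (K τ) X) * V a =
      ∫ τ in a..b, (star (V τ) * heisenberg (K τ) X * V τ -
        star (V a) * heisenberg (K τ) X * V a) := by
    rw [intervalIntegral.integral_sub hi2 hi3, h.integral_conj_heisenberg hab, ← e1, mul_add,
      add_mul, sub_sub]
  obtain ⟨hi4, e3⟩ := integral_mul_primitive hab h.finite hk hkc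
  have e4 : 2 * (∫ τ in a..b, k τ) ^ 2 * ‖X‖ =
      ∫ τ in a..b, 4 * ‖X‖ * (k τ * ∫ σ in a..τ, k σ) := by
    rw [intervalIntegral.integral_const_mul, e3]; ring
  rw [e2, e4]
  refine intervalIntegral.norm_integral_le_of_norm_le hab
    (Filter.Eventually.of_forall fun τ hτ => ?_)
    (((intervalIntegrable_iff_integrableOn_Icc_of_le hab).2 hi4).const_mul _)
  have hτ' := Ioc_subset_Icc_self hτ
  have hsub : Icc a τ ⊆ Icc a b := Icc_subset_Icc_right hτ'.2
  have hk0 : 0 ≤ ∫ σ in a..τ, k σ := intervalIntegral.integral_nonneg hτ'.1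
    fun σ hσ => (norm_nonneg _).trans (hKk σ (hsub hσ))
  calc _ ≤ 2 * (∫ σ in a..τ, k σ) * ‖heisenberg (K τ) X‖ :=
        (h.mono le_rfl hτ'.2).norm_conj_sub_conj_le hτ'.1 (fun σ hσ => hV σ (hsub hσ))
          (hk.mono_set hsub) (fun σ hσ => hKk σ (hsub hσ)) _
    _ ≤ 2 * (∫ σ in a..τ, k σ) * (2 * k τ * ‖X‖) := by
        refine mul_le_mul_of_nonneg_left ((norm_heisenberg_le _ _).trans ?_) (by positivity)
        gcongr
        exact hKk τ hτ'
    _ = _ := by ring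

/-- Presents a single exponential as the evolution under a constant Hamiltonian for unit time, so
that the preceding bounds cover the sampled unitaries too. -/
theorem isSchrodingerOn_exp {K : A} (hK : star K = K) :
    IsSchrodingerOn (fun _ => K) (fun v : ℝ => NormedSpace.exp (v • (-Complex.I • K))) ∅ 0 1 where
  finite := finite_empty
  continuousOn := by
    have : Continuous fun v : ℝ => NormedSpace.exp (v • (-Complex.I • K)) :=
      continuous_iff_continuousAt.2 fun v => (hasDerivAt_exp_smul_const' (𝕂 := ℝ) _ v).continuousAt
    exact this.continuousOn
  selfAdjoint _ _ := hK
  integrableOn := continuousOn_const.integrableOn_compact isCompact_Icc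
  hasDerivAt v _ := by
    simpa only [smul_mul_assoc] using!
      hasDerivAt_exp_smul_const' (𝕂 := ℝ) (-Complex.I • K) v

theorem norm_exp_le_one {K : A} (hK : star K = K) : ‖NormedSpace.exp (-Complex.I • K)‖ ≤ 1 := by
  simpa using! (isSchrodingerOn_exp hK).norm_le_one (by simp) (right_mem_Icc.2 zero_le_one)

theorem norm_exp_conj_sub_firstOrder_le {K : A} (hK : star K = K) (X : A) :
    ‖star (NormedSpace.exp (-Complex.I • K)) * X * NormedSpace.exp (-Complex.I • K) -
      (X + heisenberg K X)‖ ≤ 2 * ‖K‖ ^ 2 * ‖X‖ := by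
  have h := isSchrodingerOn_exp hK
  simpa using! h.norm_conj_sub_firstOrder_le zero_le_one (fun τ hτ => h.norm_le_one (by simp) hτ)
    (continuousOn_const.integrableOn_compact isCompact_Icc) continuousOn_const
    (k := fun _ => ‖K‖) (fun _ _ => le_rfl) X

end Heisenberg

/-! ### One time segment: the evolution, the sampled unitaries and the dual channel. -/

section Segment

variable {n : Type*} [Fintype n] [DecidableEq n]

theorem continuous_kroneckerOne (m : Type*) [Fintype m] [DecidableEq m] :
    Continuous (kroneckerOne m : Matrix n n ℂ →⋆ₐ[ℂ] Matrix (n × m) (n × m) ℂ) :=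
  (kroneckerOne m : Matrix n n ℂ →⋆ₐ[ℂ] _).toAlgHom.toLinearMap.continuous_of_finiteDimensional

theorem kroneckerOne_exp (m : Type*) [Fintype m] [DecidableEq m] (A : Matrix n n ℂ) :
    kroneckerOne m (NormedSpace.exp A) = NormedSpace.exp (kroneckerOne m A) := by
  let _ : NormedAlgebra ℚ (Matrix n n ℂ) := .restrictScalars ℚ ℂ _
  exact NormedSpace.map_exp (kroneckerOne m) (continuous_kroneckerOne m) A

/-- The assumptions on the Hamiltonian on a time interval `[a, b]`. -/
structure IsRegularOn (H : ℝ → Matrix n n ℂ) (S : Set ℝ) (a b : ℝ) : Prop where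
  finite : S.Finite
  isHermitian : ∀ τ ∈ Icc a b, (H τ).IsHermitian
  continuousOn : ContinuousOn H (Icc a b \ S)
  ne_zero : ∀ τ ∈ Icc a b, H τ ≠ 0
  integrableOn_norm : IntegrableOn (fun τ => ‖H τ‖) (Icc a b)

namespace IsRegularOn

variable {H : ℝ → Matrix n n ℂ} {S : Set ℝ} {a b : ℝ}

theorem mono (h : IsRegularOn H S a b) {a' b' : ℝ} (ha : a ≤ a') (hb : b' ≤ b) :
    IsRegularOn H S a' b' where
  finite := h.finite
  isHermitian τ hτ := h.isHermitian τ (Icc_subset_Icc ha hb hτ)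
  continuousOn := h.continuousOn.mono (sdiff_subset_sdiff_left (Icc_subset_Icc ha hb))
  ne_zero τ hτ := h.ne_zero τ (Icc_subset_Icc ha hb hτ)
  integrableOn_norm := h.integrableOn_norm.mono_set (Icc_subset_Icc ha hb)

theorem integrableOn (h : IsRegularOn H S a b) : IntegrableOn H (Icc a b) :=
  (integrable_norm_iff (aestronglyMeasurable_of_piecewise h.finite h.continuousOn)).1
    h.integrableOn_norm

theorem l1Norm_pos (h : IsRegularOn H S a b) (hab : a < b) : 0 < l1Norm H a b :=
  intervalIntegral.intervalIntegral_pos_of_pos_on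
    ((intervalIntegrable_iff_integrableOn_Icc_of_le hab.le).2 h.integrableOn_norm)
    (fun τ hτ => norm_pos_iff.2 (h.ne_zero τ (Ioo_subset_Icc_self hτ))) hab

theorem density_pos (h : IsRegularOn H S a b) (hab : a < b) {τ : ℝ} (hτ : τ ∈ Icc a b) :
    0 < density H a b τ :=
  div_pos (norm_pos_iff.2 (h.ne_zero τ hτ)) (h.l1Norm_pos hab)

theorem integrableOn_density (h : IsRegularOn H S a b) : IntegrableOn (density H a b) (Icc a b) :=
  h.integrableOn_norm.div_const _

theorem integral_density (h : IsRegularOn H S a b) (hab : a < b) :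
    ∫ τ in a..b, density H a b τ = 1 := by
  simp only [density, intervalIntegral.integral_div]
  exact div_self (h.l1Norm_pos hab).ne'

theorem isSchrodingerOn (h : IsRegularOn H S a b) (hab : a ≤ b) :
    IsSchrodingerOn H (timeOrderedExp H a) S a b where
  finite := h.finite
  continuousOn :=
    (timeOrderedExp_integral_eq hab h.finite h.continuousOn h.integrableOn_norm).1
  selfAdjoint τ hτ := h.isHermitian τ hτ
  integrableOn := h.integrableOn
  hasDerivAt x hx := by
    obtain ⟨hc, heq⟩ :=
      timeOrderedExp_integral_eq hab h.finite h.continuousOn h.integrableOn_norm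
    have hnhds : Icc a b \ S ∈ nhds x :=
      Filter.mem_of_superset ((isOpen_Ioo.sdiff h.finite.isClosed).mem_nhds hx)
        (sdiff_subset_sdiff_left Ioo_subset_Icc_self)
    have hfc : ContinuousOn (fun τ => H τ * timeOrderedExp H a τ) (Icc a b \ S) :=
      h.continuousOn.mul (hc.mono sdiff_subset)
    have hi : IntegrableOn (fun τ => H τ * timeOrderedExp H a τ) (Icc a b) :=
      h.integrableOn.mul_continuousOn hc isCompact_Icc
    have hd : HasDerivAt (fun v => ∫ τ in a..v, H τ * timeOrderedExp H a τ)
        (H x * timeOrderedExp H a x) x :=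
      intervalIntegral.integral_hasDerivAt_right
        ((intervalIntegrable_iff_integrableOn_Icc_of_le hx.1.1.le).2
          (hi.mono_set (Icc_subset_Icc_right hx.1.2.le)))
        ⟨_, hnhds, hfc.aestronglyMeasurable (measurableSet_Icc.diff h.finite.measurableSet)⟩
        (hfc.continuousAt hnhds)
    have hev : timeOrderedExp H a =ᶠ[nhds x]
        fun v => 1 - Complex.I • ∫ τ in a..v, H τ * timeOrderedExp H a τ :=
      Filter.eventually_of_mem hnhds fun v hv => heq v hv.1
    refine (((hd.const_smul Complex.I).const_sub 1).congr_of_eventuallyEq hev).congr_deriv ?_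
    rw [neg_smul]

theorem kroneckerOne_isSchrodingerOn (h : IsRegularOn H S a b) (hab : a ≤ b) (m : Type*)
    [Fintype m] [DecidableEq m] :
    IsSchrodingerOn (fun τ => kroneckerOne m (H τ))
      (fun τ => kroneckerOne m (timeOrderedExp H a τ)) S a b := by
  have hs := h.isSchrodingerOn hab
  have hc := continuous_kroneckerOne (n := n) m
  refine ⟨hs.finite, hc.comp_continuousOn hs.continuousOn, fun τ hτ => ?_, ?_, fun τ hτ => ?_⟩
  · rw [← map_star, hs.selfAdjoint τ hτ]
  · exact ContinuousLinearMap.integrable_comp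
      (⟨(kroneckerOne m : Matrix n n ℂ →⋆ₐ[ℂ] _).toAlgHom.toLinearMap, hc⟩ :
        Matrix n n ℂ →L[ℂ] Matrix (n × m) (n × m) ℂ) hs.integrableOn
  · have h1 := ContinuousLinearMap.hasFDerivAt
      ((⟨(kroneckerOne m : Matrix n n ℂ →⋆ₐ[ℂ] _).toAlgHom.toLinearMap, hc⟩ :
        Matrix n n ℂ →L[ℂ] Matrix (n × m) (n × m) ℂ).restrictScalars ℝ)
      (x := timeOrderedExp H a τ)
    refine (h1.comp_hasDerivAt τ (hs.hasDerivAt τ hτ)).congr_deriv ?_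
    change kroneckerOne m (-Complex.I • (H τ * timeOrderedExp H a τ)) = _
    rw [map_smul, map_mul]

theorem timeOrderedExp_self (H : ℝ → Matrix n n ℂ) (a : ℝ) : timeOrderedExp H a a = 1 := by
  rw [timeOrderedExp, tsum_eq_single 0]
  · rfl
  · rintro (_ | k) hk
    · exact absurd rfl hk
    · simp [dysonTerm]

theorem sampledUnitary_eq (H : ℝ → Matrix n n ℂ) (a b τ : ℝ) :
    sampledUnitary H a b τ =
      NormedSpace.exp (-Complex.I • ((density H a b τ : ℂ)⁻¹ • H τ)) := by
  rw [sampledUnitary, smul_smul, div_eq_mul_inv]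

theorem sampledUnitaryInv_eq_star (h : IsRegularOn H S a b) {τ : ℝ} (hτ : τ ∈ Icc a b) :
    sampledUnitaryInv H a b τ = star (sampledUnitary H a b τ) := by
  let _ : NormedAlgebra ℚ (Matrix n n ℂ) := .restrictScalars ℚ ℂ _
  have h1 : star (H τ) = H τ := h.isHermitian τ hτ
  rw [sampledUnitaryInv, sampledUnitary, NormedSpace.star_exp, star_smul, h1]
  simp

theorem star_inv_density_smul (h : IsRegularOn H S a b) {τ : ℝ} (hτ : τ ∈ Icc a b) :
    star ((density H a b τ : ℂ)⁻¹ • H τ) = (density H a b τ : ℂ)⁻¹ • H τ := by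
  have h1 : star (H τ) = H τ := h.isHermitian τ hτ
  rw [star_smul, h1]
  simp

/-- The point of sampling proportionally to `‖H τ‖`: the rescaled Hamiltonian has the same norm at
every time, so the second-order error is uniform in the sample. -/
theorem norm_inv_density_smul (h : IsRegularOn H S a b) (hab : a < b) {τ : ℝ}
    (hτ : τ ∈ Icc a b) : ‖(density H a b τ : ℂ)⁻¹ • H τ‖ = l1Norm H a b := by
  have h1 := norm_pos_iff.2 (h.ne_zero τ hτ)
  rw [norm_smul, norm_inv, Complex.norm_of_nonneg (h.density_pos hab hτ).le, density]
  field_simp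

theorem norm_sampledUnitary_le_one (h : IsRegularOn H S a b) {τ : ℝ} (hτ : τ ∈ Icc a b) :
    ‖sampledUnitary H a b τ‖ ≤ 1 := by
  rw [sampledUnitary_eq]
  exact norm_exp_le_one (h.star_inv_density_smul hτ)

theorem continuousOn_density (h : IsRegularOn H S a b) :
    ContinuousOn (density H a b) (Icc a b \ S) :=
  h.continuousOn.norm.div_const _

theorem continuousOn_sampledUnitary (h : IsRegularOn H S a b) (hab : a < b) :
    ContinuousOn (sampledUnitary H a b) (Icc a b \ S) := by
  let _ : NormedAlgebra ℚ (Matrix n n ℂ) := .restrictScalars ℚ ℂ _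
  refine (NormedSpace.exp_continuous (𝔸 := Matrix n n ℂ)).comp_continuousOn
    (ContinuousOn.smul (continuousOn_const.div
      (Complex.continuous_ofReal.comp_continuousOn h.continuousOn_density) fun τ hτ => ?_)
      h.continuousOn)
  exact Complex.ofReal_ne_zero.2 (h.density_pos hab hτ.1).ne'

/-- Measurability holds because the null set `S` carries all discontinuities; the integrable
majorant is `C` times the density. -/
theorem integrableOn_density_smul {E : Type*} [NormedAddCommGroup E] [NormedSpace ℝ E]
    (h : IsRegularOn H S a b) {F : ℝ → E} (hF : ContinuousOn F (Icc a b \ S)) {C : ℝ}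
    (hC : ∀ τ ∈ Icc a b, ‖F τ‖ ≤ C) :
    IntegrableOn (fun τ => density H a b τ • F τ) (Icc a b) := by
  have h2 : (volume : Measure ℝ).restrict (Icc a b \ S) = volume.restrict (Icc a b) :=
    Measure.restrict_congr_set (sdiff_null_ae_eq_self (h.finite.measure_zero _))
  have hm := (h.continuousOn_density.smul hF).aestronglyMeasurable (μ := volume)
    (measurableSet_Icc.diff h.finite.measurableSet)
  rw [h2] at hm
  refine Integrable.mono' (h.integrableOn_density.norm.mul_const C) hm ?_
  filter_upwards [ae_restrict_mem measurableSet_Icc] with τ hτ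
  rw [norm_smul]
  exact mul_le_mul_of_nonneg_left (hC τ hτ) (norm_nonneg _)

end IsRegularOn

/-- `Φ ↦ Tr (X (Φ ⊗ 𝟙)(B))`, as a continuous linear functional. -/
noncomputable def ampliationPairingCLM {m : Type*} [Fintype m] [DecidableEq m]
    (X B : Matrix (n × m) (n × m) ℂ) : (Matrix n n ℂ →L[ℂ] Matrix n n ℂ) →L[ℂ] ℂ :=
  ((ampliationPairing X B).comp (ContinuousLinearMap.coeLM ℂ)).toContinuousLinearMap

theorem ampliationPairingCLM_apply {m : Type*} [Fintype m] [DecidableEq m]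
    (X B : Matrix (n × m) (n × m) ℂ) (F : Matrix n n ℂ →L[ℂ] Matrix n n ℂ) :
    ampliationPairingCLM X B F = (X * ampliation m F.toLinearMap B).trace := rfl

/-- `Y ↦ Tr (Y B)`, as a continuous linear functional. -/
noncomputable def traceMulCLM (B : Matrix n n ℂ) : Matrix n n ℂ →L[ℂ] ℂ :=
  ((Matrix.traceLinearMap n ℂ ℂ).comp (LinearMap.mulRight ℂ B)).toContinuousLinearMap

theorem traceMulCLM_apply (B Y : Matrix n n ℂ) : traceMulCLM B Y = (Y * B).trace := rfl

/-- The dual of the qDRIFT channel of `[a, b]` tensored with the identity. -/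
noncomputable def dualChannel (m : Type*) [Fintype m] [DecidableEq m] (H : ℝ → Matrix n n ℂ)
    (a b : ℝ) (X : Matrix (n × m) (n × m) ℂ) : Matrix (n × m) (n × m) ℂ :=
  ∫ τ in a..b, density H a b τ • (star (kroneckerOne m (sampledUnitary H a b τ)) * X *
    kroneckerOne m (sampledUnitary H a b τ))

namespace IsRegularOn

variable {H : ℝ → Matrix n n ℂ} {S : Set ℝ} {a b : ℝ} {m : Type*} [Fintype m] [DecidableEq m]

theorem norm_kroneckerOne_sampledUnitary_le_one (h : IsRegularOn H S a b) {τ : ℝ}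
    (hτ : τ ∈ Icc a b) : ‖kroneckerOne m (sampledUnitary H a b τ)‖ ≤ 1 :=
  (norm_kroneckerOne_le _).trans (h.norm_sampledUnitary_le_one hτ)

theorem integrableOn_dual (h : IsRegularOn H S a b) (hab : a < b)
    (X : Matrix (n × m) (n × m) ℂ) :
    IntegrableOn (fun τ => density H a b τ • (star (kroneckerOne m (sampledUnitary H a b τ)) * X *
      kroneckerOne m (sampledUnitary H a b τ))) (Icc a b) := by
  have hc := (continuous_kroneckerOne (n := n) m).comp_continuousOn
    (h.continuousOn_sampledUnitary hab)
  exact h.integrableOn_density_smul ((hc.star.mul continuousOn_const).mul hc)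
    fun τ hτ => norm_star_mul_mul_le (h.norm_kroneckerOne_sampledUnitary_le_one hτ) X

/-- A probability average of contractions. -/
theorem norm_dualChannel_le (h : IsRegularOn H S a b) (hab : a < b)
    (X : Matrix (n × m) (n × m) ℂ) : ‖dualChannel m H a b X‖ ≤ ‖X‖ := by
  have e : ‖X‖ = ∫ τ in a..b, density H a b τ * ‖X‖ := by
    rw [intervalIntegral.integral_mul_const, h.integral_density hab, one_mul]
  rw [e]
  refine intervalIntegral.norm_integral_le_of_norm_le hab.le
    (Filter.Eventually.of_forall fun τ hτ => ?_)
    (((intervalIntegrable_iff_integrableOn_Icc_of_le hab.le).2 h.integrableOn_density).mul_const _)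
  have hτ' := Ioc_subset_Icc_self hτ
  rw [norm_smul, Real.norm_of_nonneg (h.density_pos hab hτ').le]
  exact mul_le_mul_of_nonneg_left
    (norm_star_mul_mul_le (h.norm_kroneckerOne_sampledUnitary_le_one hτ') X)
    (h.density_pos hab hτ').le

/-- With `K = H/p`, the weight `p` cancels in `p · i[K, X] = i[H, X]`, so the average of the
first-order terms is that of the true evolution. The remainders are bounded uniformly by `2 ℓ² ‖X‖`
and averaged with total mass one. -/
theorem norm_dualChannel_sub_firstOrder_le (h : IsRegularOn H S a b) (hab : a < b)
    (X : Matrix (n × m) (n × m) ℂ) :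
    ‖dualChannel m H a b X - (X + ∫ τ in a..b, heisenberg (kroneckerOne m (H τ)) X)‖ ≤
      2 * l1Norm H a b ^ 2 * ‖X‖ := by
  have hdi := (intervalIntegrable_iff_integrableOn_Icc_of_le hab.le).2 h.integrableOn_density
  have hXi : IntervalIntegrable (fun τ => density H a b τ • X) volume a b :=
    (intervalIntegrable_iff_integrableOn_Icc_of_le hab.le).2 (h.integrableOn_density.smul_const X)
  have hhi := (intervalIntegrable_iff_integrableOn_Icc_of_le hab.le).2
    ((h.kroneckerOne_isSchrodingerOn hab.le m).integrableOn_heisenberg X)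
  have hDi := (intervalIntegrable_iff_integrableOn_Icc_of_le hab.le).2
    (h.integrableOn_dual hab X)
  have e1 : X = ∫ τ in a..b, density H a b τ • X := by
    rw [intervalIntegral.integral_smul_const, h.integral_density hab, one_smul]
  have e2 : dualChannel m H a b X - (X + ∫ τ in a..b, heisenberg (kroneckerOne m (H τ)) X) =
      ∫ τ in a..b, (density H a b τ • (star (kroneckerOne m (sampledUnitary H a b τ)) * X *
        kroneckerOne m (sampledUnitary H a b τ)) -
          (density H a b τ • X + heisenberg (kroneckerOne m (H τ)) X)) := by
    rw [intervalIntegral.integral_sub hDi (hXi.add hhi), intervalIntegral.integral_add hXi hhi,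
      ← e1]
    rfl
  have e3 : 2 * l1Norm H a b ^ 2 * ‖X‖ =
      ∫ τ in a..b, density H a b τ * (2 * l1Norm H a b ^ 2 * ‖X‖) := by
    rw [intervalIntegral.integral_mul_const, h.integral_density hab, one_mul]
  rw [e2, e3]
  refine intervalIntegral.norm_integral_le_of_norm_le hab.le
    (Filter.Eventually.of_forall fun τ hτ => ?_) (hdi.mul_const _)
  have hτ' := Ioc_subset_Icc_self hτ
  have hd := h.density_pos hab hτ'
  set K : Matrix n n ℂ := (density H a b τ : ℂ)⁻¹ • H τ with hK
  have hU : kroneckerOne m (sampledUnitary H a b τ) =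
      NormedSpace.exp (-Complex.I • kroneckerOne m K) := by
    rw [sampledUnitary_eq, kroneckerOne_exp, map_smul]
  have hH : kroneckerOne m (H τ) = (density H a b τ : ℂ) • kroneckerOne m K := by
    rw [hK, map_smul, smul_smul, mul_inv_cancel₀ (by exact_mod_cast hd.ne'), one_smul]
  have hheis : heisenberg (kroneckerOne m (H τ)) X =
      density H a b τ • heisenberg (kroneckerOne m K) X := by
    rw [hH, heisenberg, heisenberg, smul_mul_assoc, mul_smul_comm, ← smul_sub, smul_comm,
      Complex.coe_smul]
  have hstar : star (kroneckerOne m K) = kroneckerOne m K := by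
    rw [← map_star, h.star_inv_density_smul hτ']
  rw [hheis, ← smul_add, ← smul_sub, norm_smul, Real.norm_of_nonneg hd.le, hU]
  refine mul_le_mul_of_nonneg_left ((norm_exp_conj_sub_firstOrder_le hstar X).trans ?_) hd.le
  have : ‖kroneckerOne m K‖ ≤ l1Norm H a b :=
    (norm_kroneckerOne_le _).trans (h.norm_inv_density_smul hab hτ').le
  gcongr

/-- Both sides are continuous linear functionals of an integral; taken inside, they agree pointwise
by cyclicity of the trace. -/
theorem trace_mul_ampliation_qdriftChannel (h : IsRegularOn H S a b) (hab : a < b)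
    (X B : Matrix (n × m) (n × m) ℂ) :
    (X * ampliation m (qdriftChannel H a b) B).trace = (dualChannel m H a b X * B).trace := by
  have hstar : ∀ τ ∈ Icc a b, sampledUnitaryInv H a b τ = star (sampledUnitary H a b τ) :=
    fun τ hτ => h.sampledUnitaryInv_eq_star hτ
  have hcont := h.continuousOn_sampledUnitary hab
  have hcont' : ContinuousOn (sampledUnitaryInv H a b) (Icc a b \ S) :=
    hcont.star.congr fun τ hτ => hstar τ hτ.1
  have hInt : IntervalIntegrable (fun τ => density H a b τ •
      ContinuousLinearMap.mulLeftRight ℂ (Matrix n n ℂ)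
        (sampledUnitary H a b τ) (sampledUnitaryInv H a b τ)) volume a b := by
    rw [intervalIntegrable_iff_integrableOn_Icc_of_le hab.le]
    refine h.integrableOn_density_smul (C := 1)
      (((ContinuousLinearMap.mulLeftRight ℂ (Matrix n n ℂ)).continuous.comp_continuousOn
        hcont).clm_apply hcont') fun τ hτ => ?_
    refine (ContinuousLinearMap.opNorm_mulLeftRight_apply_apply_le ℂ (Matrix n n ℂ) _ _).trans ?_
    refine mul_le_one₀ (h.norm_sampledUnitary_le_one hτ) (norm_nonneg _) ?_
    rw [hstar τ hτ, norm_star]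
    exact h.norm_sampledUnitary_le_one hτ
  have hDi := (intervalIntegrable_iff_integrableOn_Icc_of_le hab.le).2
    (h.integrableOn_dual hab X)
  have e1 := (ampliationPairingCLM X B).intervalIntegral_comp_comm hInt
  have e2 := (traceMulCLM B).intervalIntegral_comp_comm hDi
  rw [qdriftChannel, ← ampliationPairingCLM_apply, ← traceMulCLM_apply, ← e1, dualChannel, ← e2]
  refine intervalIntegral.integral_congr fun τ hτ => ?_
  rw [uIcc_of_le hab.le] at hτ
  have hamp := ampliation_apply_of_eq_mul_mul (m := m)
    (Φ := (ContinuousLinearMap.mulLeftRight ℂ (Matrix n n ℂ)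
        (sampledUnitary H a b τ) (sampledUnitaryInv H a b τ)).toLinearMap)
    (u := sampledUnitary H a b τ) (v := sampledUnitaryInv H a b τ) (fun ρ => by simp) B
  -- The density acts by real scalars while the functionals are `ℂ`-linear.
  simp only [← Complex.coe_smul, map_smul]
  rw [ampliationPairingCLM_apply, traceMulCLM_apply, hamp, hstar τ hτ, map_star, ← mul_assoc,
    Matrix.trace_mul_comm]
  simp only [mul_assoc]

end IsRegularOn

end Segment

/-! ### Accumulation of the errors and the equal-weight division. -/

section Product

variable {n : Type*} [Fintype n] [DecidableEq n] {H : ℝ → Matrix n n ℂ} {S : Set ℝ} {t : ℝ}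

namespace IsRegularOn

/-- Both terms are within `2 ℓ² ‖X‖` of the first-order map conjugated by `V a`. Since the evolution
always starts at time `0`, no composition law for `E` is needed. -/
theorem norm_conj_sub_conj_dualChannel_le {m : Type*} [Fintype m] [DecidableEq m]
    (h : IsRegularOn H S 0 t) {a b : ℝ} (ha : 0 ≤ a) (hab : a < b) (hb : b ≤ t)
    (X : Matrix (n × m) (n × m) ℂ) :
    ‖star (kroneckerOne m (timeOrderedExp H 0 b)) * X * kroneckerOne m (timeOrderedExp H 0 b) -
      star (kroneckerOne m (timeOrderedExp H 0 a)) * dualChannel m H a b X *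
        kroneckerOne m (timeOrderedExp H 0 a)‖ ≤ 4 * l1Norm H a b ^ 2 * ‖X‖ := by
  have hs := h.kroneckerOne_isSchrodingerOn (ha.trans (hab.le.trans hb)) m
  have hseg := h.mono ha hb
  have hV : ∀ τ ∈ Icc 0 t, ‖kroneckerOne m (timeOrderedExp H 0 τ)‖ ≤ 1 := fun τ hτ =>
    hs.norm_le_one (by simp [timeOrderedExp_self]) hτ
  have h1 := (hs.mono ha hb).norm_conj_sub_firstOrder_le hab.le
    (fun τ hτ => hV τ (Icc_subset_Icc ha hb hτ)) hseg.integrableOn_norm hseg.continuousOn.norm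
    (fun τ _ => norm_kroneckerOne_le _) X
  have h2 := (norm_star_mul_mul_le (hV a ⟨ha, hab.le.trans hb⟩) _).trans
    (hseg.norm_dualChannel_sub_firstOrder_le hab X)
  rw [mul_sub, sub_mul, norm_sub_rev] at h2
  calc _ ≤ _ := norm_sub_le_norm_sub_add_norm_sub _ _ _
    _ ≤ _ := add_le_add h1 h2
    _ = _ := by rw [l1Norm]; ring

/-- Telescoping from the latest segment backwards: the last channel is moved onto `X`, and the
induction hypothesis is applied to the resulting observable, whose norm is no larger. Hence the
induction runs over all `X`. -/
theorem norm_trace_ampliation_sub_le {m : Type*} [Fintype m] [DecidableEq m]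
    (h : IsRegularOn H S 0 t) {T : ℕ → ℝ} {r : ℕ} {c : ℝ} (hT0 : T 0 = 0)
    (hmem : ∀ j ≤ r, T j ∈ Icc 0 t) (hlt : ∀ j < r, T j < T (j + 1))
    (hc : ∀ j < r, l1Norm H (T j) (T (j + 1)) = c) {j : ℕ} (hj : j ≤ r)
    (X B : Matrix (n × m) (n × m) ℂ) :
    ‖(star (kroneckerOne m (timeOrderedExp H 0 (T j))) * X *
      kroneckerOne m (timeOrderedExp H 0 (T j)) * B).trace -
        (X * ampliation m (qdriftProduct H T j) B).trace‖ ≤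
      j * (4 * c ^ 2) * ‖X‖ * traceNorm B := by
  induction j generalizing X with
  | zero =>
    have hB : ampliation m (qdriftProduct H T 0) B = B := rfl
    simp [hT0, timeOrderedExp_self, hB]
  | succ j ih =>
    have hjr : j < r := hj
    have hseg := h.mono (hmem j hjr.le).1 (hmem (j + 1) hj).2
    have h1 := ih hjr.le (dualChannel m H (T j) (T (j + 1)) X)
    have hX := hseg.norm_dualChannel_le (hlt j hjr) X
    have h2 := h.norm_conj_sub_conj_dualChannel_le (hmem j hjr.le).1 (hlt j hjr)
      (hmem (j + 1) hj).2 X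
    have h3 := (norm_trace_mul_le _ B).trans
      (mul_le_mul_of_nonneg_right h2 (traceNorm_nonneg B))
    rw [sub_mul, Matrix.trace_sub, hc j hjr] at h3
    rw [← hseg.trace_mul_ampliation_qdriftChannel (hlt j hjr)] at h1
    have hB := traceNorm_nonneg B
    calc _ ≤ _ := norm_sub_le_norm_sub_add_norm_sub _ _ _
      _ ≤ _ := add_le_add h3 h1
      _ ≤ 4 * c ^ 2 * ‖X‖ * traceNorm B + j * (4 * c ^ 2) * ‖X‖ * traceNorm B := by gcongr
      _ = _ := by push_cast; ring

theorem diamondNorm_idealChannel_sub_qdriftProduct_le (h : IsRegularOn H S 0 t) {T : ℕ → ℝ}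
    {r : ℕ} {c : ℝ} (hT0 : T 0 = 0) (hmem : ∀ j ≤ r, T j ∈ Icc 0 t)
    (hlt : ∀ j < r, T j < T (j + 1)) (hc : ∀ j < r, l1Norm H (T j) (T (j + 1)) = c) :
    diamondNorm (idealChannel H 0 (T r) - qdriftProduct H T r) ≤ r * (4 * c ^ 2) := by
  refine Real.sSup_le ?_ (by positivity)
  rintro _ ⟨B, hB, rfl⟩
  have hB1 : traceNorm B ≤ 1 := hB
  refine traceNorm_le_of_forall_norm_trace_le _ fun X hX => ?_
  have h1 := h.norm_trace_ampliation_sub_le hT0 hmem hlt hc le_rfl X B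
  have h2 : (X * ampliation n (idealChannel H 0 (T r) - qdriftProduct H T r) B).trace =
      (X * ampliation n (idealChannel H 0 (T r)) B).trace -
        (X * ampliation n (qdriftProduct H T r) B).trace :=
    map_sub (ampliationPairing X B) _ _
  have h3 : ampliation n (idealChannel H 0 (T r)) B =
      kroneckerOne n (timeOrderedExp H 0 (T r)) * B *
        star (kroneckerOne n (timeOrderedExp H 0 (T r))) := by
    rw [ampliation_apply_of_eq_mul_mul (u := timeOrderedExp H 0 (T r))
      (v := star (timeOrderedExp H 0 (T r))) (fun ρ => rfl) B, map_star]
  have h4 : (X * ampliation n (idealChannel H 0 (T r)) B).trace =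
      (star (kroneckerOne n (timeOrderedExp H 0 (T r))) * X *
        kroneckerOne n (timeOrderedExp H 0 (T r)) * B).trace := by
    rw [h3, ← mul_assoc, Matrix.trace_mul_comm]
    simp only [mul_assoc]
  rw [h2, h4]
  refine h1.trans ?_
  rw [mul_assoc]
  exact mul_le_of_le_one_right (by positivity)
    (mul_le_one₀ hX (traceNorm_nonneg B) hB1)

theorem exists_division (h : IsRegularOn H S 0 t) (ht : 0 < t) {r : ℕ} (hr : 0 < r) :
    ∃ T : ℕ → ℝ, T 0 = 0 ∧ T r = t ∧ (∀ j ≤ r, T j ∈ Icc 0 t) ∧ (∀ j < r, T j < T (j + 1)) ∧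
      ∀ j < r, l1Norm H (T j) (T (j + 1)) = l1Norm H 0 t / r := by
  have hL := h.l1Norm_pos ht
  have hr' : (0 : ℝ) < r := by exact_mod_cast hr
  have hi : IntegrableOn (fun τ => ‖H τ‖) (uIcc 0 t) := by
    rw [uIcc_of_le ht.le]; exact h.integrableOn_norm
  have hc : ContinuousOn (l1Norm H 0) (Icc 0 t) := by
    have := intervalIntegral.continuousOn_primitive_interval (μ := volume) hi
    rwa [uIcc_of_le ht.le] at this
  have hex : ∀ j : ℕ, ∃ v : ℝ, (j = 0 → v = 0) ∧ (j = r → v = t) ∧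
      (j ≤ r → v ∈ Icc 0 t ∧ l1Norm H 0 v = j * (l1Norm H 0 t / r)) := by
    intro j
    by_cases h0 : j = 0
    · exact ⟨0, fun _ => rfl, fun h1 => by omega,
        fun _ => ⟨left_mem_Icc.2 ht.le, by simp [h0, l1Norm]⟩⟩
    by_cases h1 : j = r
    · refine ⟨t, fun h2 => absurd h2 h0, fun _ => rfl, fun _ => ⟨right_mem_Icc.2 ht.le, ?_⟩⟩
      rw [h1]; field_simp
    by_cases h2 : j ≤ r
    · have hmem : (j : ℝ) * (l1Norm H 0 t / r) ∈ Icc (l1Norm H 0 0) (l1Norm H 0 t) := by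
        have hj : (j : ℝ) ≤ r := by exact_mod_cast h2
        refine ⟨by simp only [l1Norm, intervalIntegral.integral_same]; positivity, ?_⟩
        calc _ ≤ (r : ℝ) * (l1Norm H 0 t / r) := by gcongr
          _ = _ := by field_simp
      obtain ⟨v, hv, he⟩ := intermediate_value_Icc ht.le hc hmem
      exact ⟨v, fun h3 => absurd h3 h0, fun h3 => absurd h3 h1, fun _ => ⟨hv, he⟩⟩
    · exact ⟨0, fun _ => rfl, fun h3 => absurd h3 h1, fun h3 => absurd h3 h2⟩
  choose T hT0 hTr hT using hex
  have hsub : ∀ {j k : ℕ}, j ≤ r → k ≤ r →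
      l1Norm H (T j) (T k) = l1Norm H 0 (T k) - l1Norm H 0 (T j) := fun {j k} hj hk => by
    have hii : ∀ {i : ℕ}, i ≤ r → IntervalIntegrable (fun τ => ‖H τ‖) volume 0 (T i) :=
      fun {i} hi' => (intervalIntegrable_iff_integrableOn_Icc_of_le (hT i hi').1.1).2
        (h.integrableOn_norm.mono_set (Icc_subset_Icc_right (hT i hi').1.2))
    exact (intervalIntegral.integral_interval_sub_left (hii hk) (hii hj)).symm
  have hstep : ∀ j < r, l1Norm H (T j) (T (j + 1)) = l1Norm H 0 t / r := fun j hj => by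
    rw [hsub hj.le hj, (hT j hj.le).2, (hT (j + 1) hj).2]
    push_cast
    ring
  refine ⟨T, hT0 0 rfl, hTr r rfl, fun j hj => (hT j hj).1, fun j hj => ?_, hstep⟩
  -- A reversed step would have nonpositive oriented weight, against `L/r > 0`.
  by_contra! hle
  have h1 : 0 ≤ l1Norm H (T (j + 1)) (T j) :=
    intervalIntegral.integral_nonneg hle fun τ _ => norm_nonneg _
  have h2 : l1Norm H (T j) (T (j + 1)) = -l1Norm H (T (j + 1)) (T j) :=
    intervalIntegral.integral_symm _ _
  have h3 : 0 < l1Norm H 0 t / r := by positivity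
  linarith [hstep j hj]

end IsRegularOn

end Product

end QDrift

theorem mainTheorem4 {n : Type*} [Fintype n] [DecidableEq n] (t : ℝ) (ht : 0 < t)
    (H : ℝ → Matrix n n ℂ)
    (hherm : ∀ τ ∈ Set.Icc 0 t, (H τ).IsHermitian)
    (hcont : ∃ S : Set ℝ, S.Finite ∧ ContinuousOn H (Set.Icc 0 t \ S))
    (hne : ∀ τ ∈ Set.Icc 0 t, H τ ≠ 0)
    (hint : MeasureTheory.IntegrableOn (fun τ => ‖H τ‖) (Set.Icc 0 t))
    (r : ℕ) (hr : 0 < r) :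
    ∃ T : ℕ → ℝ, T 0 = 0 ∧ T r = t ∧ (∀ j < r, T j < T (j + 1)) ∧
      (∀ j < r, QDrift.l1Norm H (T j) (T (j + 1)) = QDrift.l1Norm H 0 t / r) ∧
      QDrift.diamondNorm (QDrift.idealChannel H 0 t - QDrift.qdriftProduct H T r)
        ≤ 4 * QDrift.l1Norm H 0 t ^ 2 / r ∧
      ∀ ε : ℝ, 0 < ε → 4 * ⌈QDrift.l1Norm H 0 t ^ 2 / ε⌉₊ ≤ r →
        QDrift.diamondNorm (QDrift.idealChannel H 0 t - QDrift.qdriftProduct H T r) ≤ ε := by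
  obtain ⟨S, hS, hcS⟩ := hcont
  have h : QDrift.IsRegularOn H S 0 t := ⟨hS, hherm, hcS, hne, hint⟩
  have hr' : (0 : ℝ) < r := by exact_mod_cast hr
  obtain ⟨T, hT0, hTr, hmem, hlt, hstep⟩ := h.exists_division ht hr
  have hmain : QDrift.diamondNorm (QDrift.idealChannel H 0 t - QDrift.qdriftProduct H T r)
      ≤ 4 * QDrift.l1Norm H 0 t ^ 2 / r := by
    have := h.diamondNorm_idealChannel_sub_qdriftProduct_le hT0 hmem hlt hstep
    rw [hTr] at this
    refine this.trans_eq ?_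
    field_simp
  refine ⟨T, hT0, hTr, hlt, hstep, hmain, fun ε hε hrε => hmain.trans ?_⟩
  -- `r ≥ 4 ⌈L²/ε⌉ ≥ 4 L²/ε`, which is `4 L²/r ≤ ε`.
  have h1 := Nat.le_ceil (QDrift.l1Norm H 0 t ^ 2 / ε)
  have h2 : (4 : ℝ) * ⌈QDrift.l1Norm H 0 t ^ 2 / ε⌉₊ ≤ r := by exact_mod_cast hrε
  rw [div_le_iff₀ hε] at h1
  rw [div_le_iff₀ hr']
  nlinarith
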